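/- Equip $\mathbb{C}^3$ with the Hermitian form of signature $(2,1)$ \[\langle x,y\rangle=\overline{x_1}y_3+\overline{x_2}y_2+\overline{x_3}y_1 ,\] and let $\overline{\mathbb{H}}=\{[z]\in\mathbb{CP}^2 : \langle z,z\rangle\le 0\}$ be the closed complex hyperbolic plane, i.e. the complex hyperbolic plane together with its boundary at infinity. For $p,q\in\mathbb{C}^3$ let $\mathfrak{B}(p,q)=\{[z]\in\overline{\mathbb{H}} : |\langle z,p\rangle|=|\langle z,q\rangle|\}$. For $\alpha\in\,]0,\frac{\pi}{2}[$ put \[ S=\begin{pmatrix}1&\sqrt2e^{-i\alpha}&-1\\-\sqrt2e^{i\alpha}&-1&0\\-1&0&0\end{pmatrix},\quad T=\begin{pmatrix}0&0&-1\\0&-1&-\sqrt2e^{-i\alpha}\\-1&\sqrt2e^{i\alpha}&1\end{pmatrix},\quad U=S^{-1}T, \] \[ p_A=\begin{pmatrix}1\\0\\0\end{pmatrix},\quad p_B=\begin{pmatrix}0\\0\\1\end{pmatrix},\quad p_U=\begin{pmatrix}1\\-\frac{\sqrt2}{2}e^{i\alpha}\\e^{2i\alpha}\end{pmatrix},\quad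 p_V=Sp_U,\quad p_W=S^2p_U , \] so that $S^3=T^3=1$ and $Up_U=p_U$. For $k\in\mathbb{Z}$ let \[\mathcal{J}_k^+=\mathfrak{B}(p_U,U^kp_V),\qquad \mathcal{J}_k^-=\mathfrak{B}(p_U,U^kp_W).\] Let $n\ge 9$ be an integer and suppose that $[U]$ is elliptic of type $(\frac1n,-\frac1n)$ (in particular, of order $n$): up to a common scalar factor, $U$ has eigenvalues $1,e^{2i\pi/n},e^{-2i\pi/n}$ on an orthogonal basis of $\mathbb{C}^3$ whose first vector $v$ satisfies $\langle v,v\rangle<0$. Then, for all $k\in\mathbb{Z}$: \begin{enumerate} \item $\mathcal{J}_0^+\cap\mathcal{J}_k^+\neq\emptyset$ if and only if $k\equiv-1,0,1 \pmod n$; \item $\mathcal{J}_0^-\cap\mathcal{J}_k^-\neq\emptyset$ if and only if $k\equiv-1,0,1 \pmod n$; \item $\mathcal{J}_0^+\cap\mathcal{J}_k^-\neq\emptyset$ if and only if $k\equiv-2,-1,0,1 \pmod n$. \end{enumerate} Furthermore, $\mathcal{J}_0^+\cap\mathcal{J}_1^-=\{[Up_A]\}$ and $\mathcal{J}_0^+\cap\mathcal{J}_{-2}^-=\{[U^{-1}p_B]\}$.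 -/

import Mathlib

open scoped LinearAlgebra.Projectivization

noncomputable section

namespace ComplexHyperbolic

/-- The complex projective plane. -/
abbrev CP2 : Type := ℙ ℂ (Fin 3 → ℂ)

/-- The Hermitian form of signature `(2,1)` on `ℂ³` with matrix `antidiag(1,1,1)`,
conjugate-linear in the first variable. -/
def herm (x y : Fin 3 → ℂ) : ℂ :=
  star (x 0) * y 2 + star (x 1) * y 1 + star (x 2) * y 0

/-- The closed complex hyperbolic plane (the complex hyperbolic plane together with its
boundary at infinity): the lines on which the Hermitian form is non-positive. -/
def closedPlane : Set CP2 := {z | (herm z.rep z.rep).re ≤ 0}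

/-- The bisector `𝔅(p,q)` in the closed complex hyperbolic plane:
the points `[z]` such that `|⟨z,p⟩| = |⟨z,q⟩|`. -/
def bisector (p q : Fin 3 → ℂ) : Set CP2 :=
  {z | z ∈ closedPlane ∧ ‖herm z.rep p‖ = ‖herm z.rep q‖}

theorem herm_smul_left (c : ℂ) (x y : Fin 3 → ℂ) : herm (c • x) y = star c * herm x y := by
  simp only [herm, Pi.smul_apply, smul_eq_mul, star_mul']
  ring

theorem herm_smul_right (c : ℂ) (x y : Fin 3 → ℂ) : herm x (c • y) = c * herm x y := by
  simp only [herm, Pi.smul_apply, smul_eq_mul]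
  ring

/-- Membership in a bisector may be tested on any representative. -/
theorem mk_mem_bisector_iff (p q z : Fin 3 → ℂ) (hz : z ≠ 0) :
    Projectivization.mk ℂ z hz ∈ bisector p q ↔
      (herm z z).re ≤ 0 ∧ ‖herm z p‖ = ‖herm z q‖ := by
  obtain ⟨a, ha⟩ := Projectivization.exists_smul_eq_mk_rep ℂ z hz
  have ha0 : 0 < ‖(a : ℂ)‖ := norm_pos_iff.mpr a.ne_zero
  have h1 : (herm ((a : ℂ) • z) ((a : ℂ) • z)).re = ‖(a : ℂ)‖ ^ 2 * (herm z z).re := by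
    rw [herm_smul_left, herm_smul_right, ← mul_assoc, Complex.star_def, mul_comm _ (a : ℂ),
      Complex.mul_conj, Complex.re_ofReal_mul, Complex.normSq_eq_norm_sq]
  have h2 : ‖(a : ℂ)‖ ^ 2 * (herm z z).re ≤ 0 ↔ (herm z z).re ≤ 0 := by
    have h3 : 0 < ‖(a : ℂ)‖ ^ 2 := by positivity
    constructor
    · intro h
      by_contra! h4
      exact absurd (mul_pos h3 h4) (not_lt.mpr h)
    · intro h
      exact mul_nonpos_of_nonneg_of_nonpos h3.le h
  rw [Units.smul_def] at ha
  simp only [bisector, closedPlane, Set.mem_ofPred_eq, ← ha, h1, h2]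
  simp only [herm_smul_left, norm_mul, norm_star, mul_right_inj' ha0.ne']

/-- The projective action of an invertible matrix on the projective plane. -/
def act (g : GL (Fin 3) ℂ) (z : CP2) : CP2 :=
  z.map (Matrix.GeneralLinearGroup.toLin g).toLinearEquiv.toLinearMap
    (Matrix.GeneralLinearGroup.toLin g).toLinearEquiv.injective

/-- `[g]` is elliptic of type `(a,b)`: up to a common scalar `c`, the matrix `g` is diagonal
with eigenvalues `1, e^{2iπa}, e^{2iπb}` in an orthogonal basis of `ℂ³` whose first vector `v`
is negative; thus `[v]` is a fixed point of `[g]` in the complex hyperbolic plane, around which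
`[g]` rotates by the angles `2πa` and `2πb`. -/
def IsEllipticOfType (g : GL (Fin 3) ℂ) (a b : ℝ) : Prop :=
  ∃ (c : ℂ) (v v₁ v₂ : Fin 3 → ℂ),
    (herm v v).re < 0 ∧ v₁ ≠ 0 ∧ v₂ ≠ 0 ∧
    herm v v₁ = 0 ∧ herm v v₂ = 0 ∧ herm v₁ v₂ = 0 ∧
    g.1.mulVec v = c • v ∧
    g.1.mulVec v₁ = (c * Complex.exp (2 * Real.pi * a * Complex.I)) • v₁ ∧
    g.1.mulVec v₂ = (c * Complex.exp (2 * Real.pi * b * Complex.I)) • v₂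

/-- `e^{iα}`. -/
def ei (α : ℝ) : ℂ := Complex.exp (α * Complex.I)

theorem ei_ne_zero (α : ℝ) : ei α ≠ 0 := Complex.exp_ne_zero _

/-- The matrix of the order three generator `S`. -/
def matS (α : ℝ) : Matrix (Fin 3) (Fin 3) ℂ :=
  !![1, (√2 : ℝ) * (ei α)⁻¹, -1; -((√2 : ℝ) * ei α), -1, 0; -1, 0, 0]

/-- The matrix of the order three generator `T`. -/
def matT (α : ℝ) : Matrix (Fin 3) (Fin 3) ℂ :=
  !![0, 0, -1; 0, -1, -((√2 : ℝ) * (ei α)⁻¹); -1, (√2 : ℝ) * ei α, 1]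

theorem sqrt_two_mul_self : ((√2 : ℝ) : ℂ) * ((√2 : ℝ) : ℂ) = 2 := by
  rw [← Complex.ofReal_mul, Real.mul_self_sqrt (by norm_num)]
  norm_num

theorem matS_cube (α : ℝ) : matS α * (matS α * matS α) = 1 := by
  have h := ei_ne_zero α
  have h2 := sqrt_two_mul_self
  ext i j
  fin_cases i <;> fin_cases j <;>
    simp [matS, Matrix.mul_apply, Fin.sum_univ_three] <;> field_simp <;> grind

theorem matT_cube (α : ℝ) : matT α * (matT α * matT α) = 1 := by
  have h := ei_ne_zero α
  have h2 := sqrt_two_mul_self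
  ext i j
  fin_cases i <;> fin_cases j <;>
    simp [matT, Matrix.mul_apply, Fin.sum_univ_three] <;> field_simp <;> grind

/-- The order three generator `S`. -/
def S (α : ℝ) : GL (Fin 3) ℂ where
  val := matS α
  inv := matS α * matS α
  val_inv := matS_cube α
  inv_val := by rw [Matrix.mul_assoc]; exact matS_cube α

/-- The order three generator `T`. -/
def T (α : ℝ) : GL (Fin 3) ℂ where
  val := matT α
  inv := matT α * matT α
  val_inv := matT_cube α
  inv_val := by rw [Matrix.mul_assoc]; exact matT_cube α

/-- `U = S⁻¹ T`. -/
def U (α : ℝ) : GL (Fin 3) ℂ := (S α)⁻¹ * T α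

/-- The fixed vector of `U`. -/
def pU (α : ℝ) : Fin 3 → ℂ := ![1, -((√2 : ℝ) / 2 * ei α), ei α ^ 2]

/-- `p_V = S p_U`. -/
def pV (α : ℝ) : Fin 3 → ℂ := (S α).1.mulVec (pU α)

/-- `p_W = S² p_U`. -/
def pW (α : ℝ) : Fin 3 → ℂ := (S α ^ 2).1.mulVec (pU α)

/-- The point `[p_A]`, where `p_A = (1,0,0)`. -/
def ptA : CP2 := Projectivization.mk ℂ ![1, 0, 0] (fun h => by simpa using congrFun h 0)

/-- The point `[p_B]`, where `p_B = (0,0,1)`. -/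
def ptB : CP2 := Projectivization.mk ℂ ![0, 0, 1] (fun h => by simpa using congrFun h 2)

/-- The bisector `𝒥_k^+ = 𝔅(p_U, U^k p_V)`. -/
def Jplus (α : ℝ) (k : ℤ) : Set CP2 := bisector (pU α) ((U α ^ k).1.mulVec (pV α))

/-- The bisector `𝒥_k^- = 𝔅(p_U, U^k p_W)`. -/
def Jminus (α : ℝ) (k : ℤ) : Set CP2 := bisector (pU α) ((U α ^ k).1.mulVec (pW α))

end ComplexHyperbolic

end

namespace ComplexHyperbolic

open Matrix

/-! Write θ = 2π/n, N = 1 - cos θ and e = p_U. The isometry `U` fixes e, so every vector p in the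
orbits of p_V and p_W satisfies ⟨e,p⟩ = -3/2 and ⟨p,p⟩ = ⟨e,e⟩ = -N.

Emptiness comes from a convexity bound, `le_re_herm_of_equidistant`. Suppose [z] lies on 𝔅(e,p) and
𝔅(e,q), with z scaled so that ⟨e,z⟩ = 2N - 3 = ⟨e, p+q-2e⟩. Then w = z - (p+q-2e) is orthogonal to
the negative vector e, so ⟨w,w⟩ ≥ 0. Expanding, with ⟨z,z⟩ ≤ 0 and |⟨p,z⟩| = |⟨q,z⟩| = 3 - 2N, gives
0 ≤ ⟨w,w⟩ ≤ 2(Re⟨p,q⟩ + 6 - 3N). Hence Re⟨p,q⟩ ≥ 3N - 6, and equality forces w = 0, so [z] =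
[p+q-2e] is unique.

Ellipticity fixes the trace of `U` and gives `U ^ n = 1` (`cos_and_pow_of_elliptic`). By the
characteristic equation, k ↦ Re⟨p, U^k q⟩ satisfies a linear recurrence with solutions 1, cos kθ,
sin kθ. Three initial values yield closed forms (`re_herm_zpow_U_self`, `re_herm_pV_zpow_U_pW`),
which lie strictly below 3N - 6 outside the listed residues. For the pair (+,-) they equal 3N - 6 at
k = 1 and k = -2, whence the single points.

Nonemptiness is witnessed by [p_A], [p_B] and their translates, since `U` shifts the indices of both
families of bisectors. -/

/-! ### The Hermitian form and the bound for equidistant points -/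

theorem herm_add_left (x y z : Fin 3 → ℂ) : herm (x + y) z = herm x z + herm y z := by
  simp only [herm, Pi.add_apply, star_add]
  ring

theorem herm_add_right (x y z : Fin 3 → ℂ) : herm x (y + z) = herm x y + herm x z := by
  simp only [herm, Pi.add_apply]
  ring

theorem herm_sub_left (x y z : Fin 3 → ℂ) : herm (x - y) z = herm x z - herm y z := by
  simp only [herm, Pi.sub_apply, star_sub]
  ring

theorem herm_sub_right (x y z : Fin 3 → ℂ) : herm x (y - z) = herm x y - herm x z := by
  simp only [herm, Pi.sub_apply]
  ring

theorem star_herm (x y : Fin 3 → ℂ) : star (herm x y) = herm y x := by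
  simp only [herm, star_add, star_mul', star_star]
  ring

theorem re_herm_comm (x y : Fin 3 → ℂ) : (herm x y).re = (herm y x).re := by
  rw [← star_herm x y, Complex.star_def, Complex.conj_re]

theorem norm_herm_comm (x y : Fin 3 → ℂ) : ‖herm x y‖ = ‖herm y x‖ := by
  rw [← star_herm x y, norm_star]

/-- The coordinates x₀ + x₂, x₀ - x₂, x₁ diagonalize the form and exhibit the signature (2,1), with
x₀ - x₂ as the negative direction. -/
theorem two_mul_herm (x y : Fin 3 → ℂ) :
    2 * herm x y = star (x 0 + x 2) * (y 0 + y 2) - star (x 0 - x 2) * (y 0 - y 2)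
      + 2 * (star (x 1) * y 1) := by
  simp only [herm, star_add, star_sub]
  ring

theorem two_mul_re_herm_self (x : Fin 3 → ℂ) :
    2 * (herm x x).re = ‖x 0 + x 2‖ ^ 2 - ‖x 0 - x 2‖ ^ 2 + 2 * ‖x 1‖ ^ 2 := by
  have h := congrArg Complex.re (two_mul_herm x x)
  simp only [Complex.star_def, ← Complex.normSq_eq_conj_mul_self, Complex.normSq_eq_norm_sq] at h
  simpa [← Complex.ofReal_pow] using h

/-- The orthogonal complement of a negative vector is positive definite. -/
theorem re_herm_self_pos {e y : Fin 3 → ℂ} (he : (herm e e).re < 0) (h : herm e y = 0)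
    (hy : y ≠ 0) : 0 < (herm y y).re := by
  have hee := two_mul_re_herm_self e
  have hyy := two_mul_re_herm_self y
  have hey := two_mul_herm e y
  rw [h] at hey
  have hle : ‖e 0 - e 2‖ * ‖y 0 - y 2‖ ≤ ‖e 0 + e 2‖ * ‖y 0 + y 2‖ + 2 * (‖e 1‖ * ‖y 1‖) := by
    have : star (e 0 - e 2) * (y 0 - y 2)
        = star (e 0 + e 2) * (y 0 + y 2) + 2 * (star (e 1) * y 1) := by
      linear_combination hey
    calc _ = ‖star (e 0 - e 2) * (y 0 - y 2)‖ := by rw [norm_mul, norm_star]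
      _ ≤ _ := by
        rw [this]
        refine (norm_add_le _ _).trans (le_of_eq ?_)
        simp only [norm_mul, norm_star, Complex.norm_ofNat]
  by_contra! hneg
  -- Reversed Cauchy–Schwarz: if ⟨y,y⟩ ≤ 0 and y₀ ≠ y₂, squaring `hle` and applying Cauchy–Schwarz
  -- to its right side contradicts ⟨e,e⟩ < 0.
  have hy0 : ‖y 0 - y 2‖ = 0 := by
    by_contra hne
    have hs : 0 < ‖y 0 - y 2‖ ^ 2 := by positivity
    have h1 := pow_le_pow_left₀ (by positivity) hle 2
    have h2 : (‖e 0 + e 2‖ * ‖y 0 + y 2‖ + 2 * (‖e 1‖ * ‖y 1‖)) ^ 2 ≤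
        (‖e 0 + e 2‖ ^ 2 + 2 * ‖e 1‖ ^ 2) * (‖y 0 + y 2‖ ^ 2 + 2 * ‖y 1‖ ^ 2) := by
      nlinarith [sq_nonneg (‖e 0 + e 2‖ * ‖y 1‖ - ‖e 1‖ * ‖y 0 + y 2‖)]
    have h3 : (‖e 0 + e 2‖ ^ 2 + 2 * ‖e 1‖ ^ 2) * (‖y 0 + y 2‖ ^ 2 + 2 * ‖y 1‖ ^ 2) ≤
        (‖e 0 + e 2‖ ^ 2 + 2 * ‖e 1‖ ^ 2) * ‖y 0 - y 2‖ ^ 2 :=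
      mul_le_mul_of_nonneg_left (by linarith) (by positivity)
    have h4 : (‖e 0 + e 2‖ ^ 2 + 2 * ‖e 1‖ ^ 2) * ‖y 0 - y 2‖ ^ 2 <
        ‖e 0 - e 2‖ ^ 2 * ‖y 0 - y 2‖ ^ 2 :=
      mul_lt_mul_of_pos_right (by linarith) hs
    rw [mul_pow] at h1
    linarith
  have hp : ‖y 0 + y 2‖ = 0 := by
    rw [hy0] at hyy
    nlinarith [sq_nonneg ‖y 0 + y 2‖, sq_nonneg ‖y 1‖]
  have hq : ‖y 1‖ = 0 := by
    rw [hy0] at hyy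
    nlinarith [sq_nonneg ‖y 0 + y 2‖, sq_nonneg ‖y 1‖]
  rw [norm_eq_zero] at hy0 hp hq
  apply hy
  ext i
  fin_cases i
  · show y 0 = 0
    linear_combination (hy0 + hp) / 2
  · exact hq
  · show y 2 = 0
    linear_combination (hp - hy0) / 2

/-- If a point of the closed complex hyperbolic plane lies on the bisectors `𝔅(e,p)` and `𝔅(e,q)`,
then `⟨p,q⟩` is bounded from below, and in the extremal case the point is determined. -/
theorem le_re_herm_of_equidistant {e p q z : Fin 3 → ℂ} {N : ℝ} (hN : 0 < N) (hN1 : N < 3 / 2)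
    (hee : herm e e = -(N : ℂ)) (hep : herm e p = -(3 / 2)) (heq : herm e q = -(3 / 2))
    (hpp : herm p p = -(N : ℂ)) (hqq : herm q q = -(N : ℂ)) (hz : z ≠ 0)
    (hzz : (herm z z).re ≤ 0) (hp : ‖herm z e‖ = ‖herm z p‖) (hq : ‖herm z e‖ = ‖herm z q‖) :
    3 * N - 6 ≤ (herm p q).re ∧
      ((herm p q).re = 3 * N - 6 → ∃ c : ℂ, c ≠ 0 ∧ c • z = p + q - (2 : ℂ) • e) := by
  have hneg : (herm e e).re < 0 := by rw [hee]; simpa using hN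
  have hze : herm e z ≠ 0 := fun h => absurd (re_herm_self_pos hneg h hz) (not_lt.mpr hzz)
  have hN2 : (2 * N - 3 : ℂ) ≠ 0 := by
    have : (2 * N - 3 : ℝ) ≠ 0 := by linarith
    exact_mod_cast this
  -- This scaling gives `c • z` the same product with e as p + q - 2e, so that their difference w
  -- below is orthogonal to e.
  set c : ℂ := (2 * N - 3) / herm e z with hc
  have hc0 : c ≠ 0 := div_ne_zero hN2 hze
  set z' := c • z with hz'
  have hz'e : herm e z' = ((2 * N - 3 : ℝ) : ℂ) := by
    rw [hz', herm_smul_right, hc, div_mul_cancel₀ _ hze]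
    push_cast
    ring
  have hz'z' : (herm z' z').re ≤ 0 := by
    rw [hz', herm_smul_left, herm_smul_right, ← mul_assoc, Complex.star_def, mul_comm _ c,
      Complex.mul_conj, Complex.re_ofReal_mul]
    exact mul_nonpos_of_nonneg_of_nonpos (Complex.normSq_nonneg _) hzz
  have hnorm : ‖herm e z'‖ = 3 - 2 * N := by
    rw [hz'e, Complex.norm_real, Real.norm_eq_abs, abs_of_neg (by linarith)]
    ring
  have hnp : ‖herm p z'‖ = 3 - 2 * N := by
    rw [← hnorm, hz', herm_smul_right, herm_smul_right, norm_mul, norm_mul, norm_herm_comm e,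
      norm_herm_comm p, hp]
  have hnq : ‖herm q z'‖ = 3 - 2 * N := by
    rw [← hnorm, hz', herm_smul_right, herm_smul_right, norm_mul, norm_mul, norm_herm_comm e,
      norm_herm_comm q, hq]
  have hrp : -(3 - 2 * N) ≤ (herm p z').re := by
    rw [← hnp]; exact (abs_le.mp (Complex.abs_re_le_norm _)).1
  have hrq : -(3 - 2 * N) ≤ (herm q z').re := by
    rw [← hnq]; exact (abs_le.mp (Complex.abs_re_le_norm _)).1
  set w := z' - (p + q - (2 : ℂ) • e) with hw
  have hew : herm e w = 0 := by
    rw [hw, herm_sub_right, herm_sub_right, herm_add_right, hz'e, herm_smul_right, hep, heq, hee]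
    push_cast
    ring
  -- By `hrp` and `hrq`, the terms in ⟨p,z'⟩ and ⟨q,z'⟩ contribute at most 4(3 - 2N), which cancels
  -- 4(2N - 3). The last summand is ⟨p+q-2e, p+q-2e⟩.
  have hww : (herm w w).re = (herm z' z').re - 2 * (herm p z').re - 2 * (herm q z').re
      + 4 * (2 * N - 3) + 2 * ((herm p q).re + 6 - 3 * N) := by
    have e1 : (herm z' p).re = (herm p z').re := re_herm_comm _ _
    have e2 : (herm z' q).re = (herm q z').re := re_herm_comm _ _
    have e3 : (herm z' e).re = 2 * N - 3 := by rw [re_herm_comm, hz'e, Complex.ofReal_re]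
    have e4 : (herm e z').re = 2 * N - 3 := by rw [hz'e, Complex.ofReal_re]
    have e5 : (herm e p).re = -(3 / 2) := by rw [hep]; norm_num
    have e6 : (herm p e).re = -(3 / 2) := by rw [re_herm_comm, e5]
    have e7 : (herm e q).re = -(3 / 2) := by rw [heq]; norm_num
    have e8 : (herm q e).re = -(3 / 2) := by rw [re_herm_comm, e7]
    have e9 : (herm q p).re = (herm p q).re := re_herm_comm _ _
    have e10 : (herm e e).re = -N := by rw [hee]; simp
    have e11 : (herm p p).re = -N := by rw [hpp]; simp
    have e12 : (herm q q).re = -N := by rw [hqq]; simp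
    simp only [hw, herm_sub_left, herm_sub_right, herm_add_left, herm_add_right, herm_smul_left,
      herm_smul_right, Complex.sub_re, Complex.add_re, star_ofNat, Complex.mul_re,
      Complex.re_ofNat, Complex.im_ofNat, zero_mul, sub_zero, e1, e2, e3, e4, e5, e6, e7, e8, e9,
      e10, e11, e12]
    ring
  constructor
  · by_cases hw0 : w = 0
    · have : (herm w w).re = 0 := by rw [hw0]; simp [herm]
      linarith
    · linarith [re_herm_self_pos hneg hew hw0]
  · intro hpq
    refine ⟨c, hc0, ?_⟩
    by_contra hne
    have := re_herm_self_pos hneg hew (sub_ne_zero.mpr hne)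
    linarith

/-! ### Isometries and explicit Hermitian products -/

/-- The invertible matrices that preserve the Hermitian form. -/
def isometryGroup : Subgroup (GL (Fin 3) ℂ) where
  carrier := {g | ∀ x y, herm (g.1 *ᵥ x) (g.1 *ᵥ y) = herm x y}
  one_mem' := by intro x y; simp
  mul_mem' := by
    intro g h hg hh x y
    simp only [Units.val_mul, ← Matrix.mulVec_mulVec]
    rw [hg, hh]
  inv_mem' := by
    intro g hg x y
    have h := hg ((g⁻¹).1 *ᵥ x) ((g⁻¹).1 *ᵥ y)
    simpa only [Matrix.mulVec_mulVec, Units.mul_inv, Matrix.one_mulVec] using h.symm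

theorem star_ei (α : ℝ) : star (ei α) = (ei α)⁻¹ := by
  rw [ei, Complex.star_def, ← Complex.exp_conj, ← Complex.exp_neg]
  simp

theorem star_ei_inv (α : ℝ) : star (ei α)⁻¹ = ei α := by
  rw [← star_ei, star_star]

theorem star_sqrt_two : star ((√2 : ℝ) : ℂ) = ((√2 : ℝ) : ℂ) := Complex.conj_ofReal _

theorem U_val (α : ℝ) : (U α).1 =
    !![1, -((√2 : ℝ) * ei α), -1;
      -((√2 : ℝ) * ei α), 1 + 2 * ei α ^ 2, (√2 : ℝ) * (ei α + (ei α)⁻¹);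
      -1, (√2 : ℝ) * (ei α + (ei α)⁻¹), 2 + 2 * (ei α)⁻¹ ^ 2] := by
  have h1 : ei α * (ei α)⁻¹ = 1 := mul_inv_cancel₀ (ei_ne_zero α)
  have h2 := sqrt_two_mul_self
  change matS α * matS α * matT α = _
  simp only [matS, matT]
  -- Only the relations e f = 1 and r² = 2 matter, so each entry becomes a polynomial identity
  -- modulo them.
  generalize (ei α)⁻¹ = f at *
  generalize ei α = e at *
  generalize ((√2 : ℝ) : ℂ) = r at *
  ext i j
  fin_cases i <;> fin_cases j <;>
    simp [Matrix.mul_apply, Fin.sum_univ_three] <;> grind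

theorem S_mem_isometryGroup (α : ℝ) : S α ∈ isometryGroup := by
  intro x y
  have h1 : ei α * (ei α)⁻¹ = 1 := mul_inv_cancel₀ (ei_ne_zero α)
  have h2 := sqrt_two_mul_self
  simp only [S, matS, herm, Matrix.mulVec, dotProduct, Fin.sum_univ_three, Matrix.of_apply,
    Matrix.cons_val, star_add, star_mul', star_neg, star_sqrt_two, star_ei, star_ei_inv,
    star_one, star_zero]
  generalize (ei α)⁻¹ = f at *
  generalize ei α = e at *
  generalize ((√2 : ℝ) : ℂ) = r at *
  generalize star (x 0) = x0, star (x 1) = x1, star (x 2) = x2, y 0 = y0, y 1 = y1, y 2 = y2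
  grind

theorem T_mem_isometryGroup (α : ℝ) : T α ∈ isometryGroup := by
  intro x y
  have h1 : ei α * (ei α)⁻¹ = 1 := mul_inv_cancel₀ (ei_ne_zero α)
  have h2 := sqrt_two_mul_self
  simp only [T, matT, herm, Matrix.mulVec, dotProduct, Fin.sum_univ_three, Matrix.of_apply,
    Matrix.cons_val, star_add, star_mul', star_neg, star_sqrt_two, star_ei, star_ei_inv,
    star_one, star_zero]
  generalize (ei α)⁻¹ = f at *
  generalize ei α = e at *
  generalize ((√2 : ℝ) : ℂ) = r at *
  generalize star (x 0) = x0, star (x 1) = x1, star (x 2) = x2, y 0 = y0, y 1 = y1, y 2 = y2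
  grind

theorem U_mem_isometryGroup (α : ℝ) : U α ∈ isometryGroup :=
  mul_mem (inv_mem (S_mem_isometryGroup α)) (T_mem_isometryGroup α)

theorem herm_zpow_U (α : ℝ) (k : ℤ) (x y : Fin 3 → ℂ) :
    herm ((U α ^ k).1 *ᵥ x) ((U α ^ k).1 *ᵥ y) = herm x y :=
  zpow_mem (U_mem_isometryGroup α) k x y

theorem pV_eq (α : ℝ) : pV α = ![-ei α ^ 2, -((√2 : ℝ) / 2 * ei α), -1] := by
  have h1 : ei α * (ei α)⁻¹ = 1 := mul_inv_cancel₀ (ei_ne_zero α)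
  have h2 := sqrt_two_mul_self
  simp only [pV, pU, S, matS]
  generalize (ei α)⁻¹ = f at *
  generalize ei α = e at *
  generalize ((√2 : ℝ) : ℂ) = r at *
  ext i
  fin_cases i <;> simp [Matrix.mulVec, dotProduct, Fin.sum_univ_three] <;> grind

theorem pW_eq (α : ℝ) :
    pW α = ![-ei α ^ 2, (√2 : ℝ) * ei α * (ei α ^ 2 + 1 / 2), ei α ^ 2] := by
  have h1 : ei α * (ei α)⁻¹ = 1 := mul_inv_cancel₀ (ei_ne_zero α)
  have h2 := sqrt_two_mul_self
  have h : pW α = (S α).1 *ᵥ pV α := by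
    rw [pW, pV, sq, Units.val_mul, Matrix.mulVec_mulVec]
  rw [h, pV_eq]
  simp only [S, matS]
  generalize (ei α)⁻¹ = f at *
  generalize ei α = e at *
  generalize ((√2 : ℝ) : ℂ) = r at *
  ext i
  fin_cases i <;> simp [Matrix.mulVec, dotProduct, Fin.sum_univ_three] <;> grind

theorem U_mulVec_pU (α : ℝ) : (U α).1 *ᵥ pU α = pU α := by
  have h1 : ei α * (ei α)⁻¹ = 1 := mul_inv_cancel₀ (ei_ne_zero α)
  have h2 := sqrt_two_mul_self
  rw [U_val]
  simp only [pU]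
  generalize (ei α)⁻¹ = f at *
  generalize ei α = e at *
  generalize ((√2 : ℝ) : ℂ) = r at *
  ext i
  fin_cases i <;> simp [Matrix.mulVec, dotProduct, Fin.sum_univ_three] <;> grind

theorem trace_U (α : ℝ) : (U α).1.trace = 4 + 2 * (ei α ^ 2 + (ei α)⁻¹ ^ 2) := by
  rw [U_val, Matrix.trace_fin_three]
  simp only [Matrix.of_apply, Matrix.cons_val]
  ring

theorem det_U (α : ℝ) : (U α).1.det = 1 := by
  have h1 : ei α * (ei α)⁻¹ = 1 := mul_inv_cancel₀ (ei_ne_zero α)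
  have h2 := sqrt_two_mul_self
  rw [U_val, Matrix.det_fin_three]
  simp only [Matrix.of_apply, Matrix.cons_val]
  generalize (ei α)⁻¹ = f at *
  generalize ei α = e at *
  generalize ((√2 : ℝ) : ℂ) = r at *
  grind

/-- The Cayley–Hamilton relation X³ = tX² - tX + 1 with t = tr U. It is the source of the recurrence
in k. -/
theorem U_pow_three (α : ℝ) : (U α).1 ^ 3 =
    (4 + 2 * (ei α ^ 2 + (ei α)⁻¹ ^ 2)) • (U α).1 ^ 2
      - (4 + 2 * (ei α ^ 2 + (ei α)⁻¹ ^ 2)) • (U α).1 + 1 := by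
  have h1 : ei α * (ei α)⁻¹ = 1 := mul_inv_cancel₀ (ei_ne_zero α)
  have h2 := sqrt_two_mul_self
  rw [U_val]
  generalize (ei α)⁻¹ = f at *
  generalize ei α = e at *
  generalize ((√2 : ℝ) : ℂ) = r at *
  ext i j
  fin_cases i <;> fin_cases j <;>
    simp [pow_succ, Matrix.mul_apply, Fin.sum_univ_three] <;> grind

theorem herm_pU_pU (α : ℝ) : herm (pU α) (pU α) = ei α ^ 2 + (ei α)⁻¹ ^ 2 + 1 / 2 := by
  have h1 : ei α * (ei α)⁻¹ = 1 := mul_inv_cancel₀ (ei_ne_zero α)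
  have h2 := sqrt_two_mul_self
  simp only [pU, herm, Matrix.cons_val, star_mul', star_neg, star_pow, star_sqrt_two,
    star_ei, star_one, star_div₀, star_ofNat]
  grind

theorem herm_pU_pV (α : ℝ) : herm (pU α) (pV α) = -(3 / 2) := by
  have h1 : ei α * (ei α)⁻¹ = 1 := mul_inv_cancel₀ (ei_ne_zero α)
  have h2 := sqrt_two_mul_self
  simp only [pU, pV_eq, herm, Matrix.cons_val, star_mul', star_neg, star_pow,
    star_sqrt_two, star_ei, star_one, star_div₀, star_ofNat]
  grind

theorem herm_pV_pV (α : ℝ) : herm (pV α) (pV α) = herm (pU α) (pU α) :=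
  S_mem_isometryGroup α _ _

theorem herm_pW_pW (α : ℝ) : herm (pW α) (pW α) = herm (pU α) (pU α) :=
  pow_mem (S_mem_isometryGroup α) 2 _ _

theorem herm_pV_pW (α : ℝ) : herm (pV α) (pW α) = -(3 / 2) := by
  have h : pW α = (S α).1 *ᵥ pV α := by
    rw [pW, pV, sq, Units.val_mul, Matrix.mulVec_mulVec]
  rw [h, pV, S_mem_isometryGroup α, ← pV, herm_pU_pV]

theorem herm_pU_pW (α : ℝ) : herm (pU α) (pW α) = -(3 / 2) := by
  have h1 : ei α * (ei α)⁻¹ = 1 := mul_inv_cancel₀ (ei_ne_zero α)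
  have h2 := sqrt_two_mul_self
  simp only [pU, pW_eq, herm, Matrix.cons_val, star_mul', star_neg, star_pow,
    star_sqrt_two, star_ei, star_one, star_div₀, star_ofNat]
  grind

/-- Turns a statement about a real part into an algebraic identity in e^{iα}, e^{-iα} and √2, the
conjugate being computed explicitly. -/
theorem re_eq_of_add_star {z : ℂ} {x : ℝ} (h : z + star z = 2 * (x : ℂ)) : z.re = x := by
  have := congrArg Complex.re h
  simp only [Complex.star_def, Complex.add_re, Complex.conj_re, Complex.mul_re, Complex.re_ofNat,
    Complex.ofReal_re, Complex.im_ofNat, zero_mul, sub_zero] at this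
  linarith

theorem herm_U_pV_pW (α : ℝ) : herm ((U α).1 *ᵥ pV α) (pW α) = -(3 / 2) := by
  have h1 : ei α * (ei α)⁻¹ = 1 := mul_inv_cancel₀ (ei_ne_zero α)
  have h2 := sqrt_two_mul_self
  simp only [U_val, pV_eq, pW_eq, herm, Matrix.mulVec, dotProduct, Fin.sum_univ_three,
    Matrix.of_apply, Matrix.cons_val, star_add, star_mul', star_neg, star_pow, star_sqrt_two,
    star_ei, star_ei_inv, star_one, star_div₀, star_ofNat]
  generalize (ei α)⁻¹ = f at *
  generalize ei α = e at *
  generalize ((√2 : ℝ) : ℂ) = r at *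
  grind

theorem re_herm_pV_U_pV {α C : ℝ} (hC : ei α ^ 2 + (ei α)⁻¹ ^ 2 = ((C - 3 / 2 : ℝ) : ℂ)) :
    (herm (pV α) ((U α).1 *ᵥ pV α)).re = -(9 / 4) - (1 - C) * C := by
  have h1 : ei α * (ei α)⁻¹ = 1 := mul_inv_cancel₀ (ei_ne_zero α)
  have h2 := sqrt_two_mul_self
  apply re_eq_of_add_star
  push_cast at hC ⊢
  simp only [U_val, pV_eq, herm, Matrix.mulVec, dotProduct, Fin.sum_univ_three,
    Matrix.of_apply, Matrix.cons_val, star_add, star_mul', star_neg, star_pow, star_sqrt_two,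
    star_ei, star_ei_inv, star_one, star_div₀, star_ofNat]
  generalize (ei α)⁻¹ = f at *
  generalize ei α = e at *
  generalize ((√2 : ℝ) : ℂ) = r at *
  grind

theorem re_herm_pW_U_pW {α C : ℝ} (hC : ei α ^ 2 + (ei α)⁻¹ ^ 2 = ((C - 3 / 2 : ℝ) : ℂ)) :
    (herm (pW α) ((U α).1 *ᵥ pW α)).re = -(9 / 4) - (1 - C) * C := by
  have h1 : ei α * (ei α)⁻¹ = 1 := mul_inv_cancel₀ (ei_ne_zero α)
  have h2 := sqrt_two_mul_self
  apply re_eq_of_add_star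
  push_cast at hC ⊢
  simp only [U_val, pW_eq, herm, Matrix.mulVec, dotProduct, Fin.sum_univ_three,
    Matrix.of_apply, Matrix.cons_val, star_add, star_mul', star_neg, star_pow, star_sqrt_two,
    star_ei, star_ei_inv, star_one, star_div₀, star_ofNat]
  generalize (ei α)⁻¹ = f at *
  generalize ei α = e at *
  generalize ((√2 : ℝ) : ℂ) = r at *
  grind

/-- With C = cos θ this is exactly the extremal value 3N - 6, so index 1 is the equality case. -/
theorem re_herm_pV_U_pW {α C : ℝ} (hC : ei α ^ 2 + (ei α)⁻¹ ^ 2 = ((C - 3 / 2 : ℝ) : ℂ)) :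
    (herm (pV α) ((U α).1 *ᵥ pW α)).re = 3 * (1 - C) - 6 := by
  have h1 : ei α * (ei α)⁻¹ = 1 := mul_inv_cancel₀ (ei_ne_zero α)
  have h2 := sqrt_two_mul_self
  apply re_eq_of_add_star
  push_cast at hC ⊢
  simp only [U_val, pV_eq, pW_eq, herm, Matrix.mulVec, dotProduct, Fin.sum_univ_three,
    Matrix.of_apply, Matrix.cons_val, star_add, star_mul', star_neg, star_pow, star_sqrt_two,
    star_ei, star_ei_inv, star_one, star_div₀, star_ofNat]
  generalize (ei α)⁻¹ = f at *
  generalize ei α = e at *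
  generalize ((√2 : ℝ) : ℂ) = r at *
  grind

/-! ### Consequences of ellipticity -/

/-- An elliptic element is diagonalizable. -/
theorem IsEllipticOfType.exists_diagonalization {g : GL (Fin 3) ℂ} {a b : ℝ}
    (h : IsEllipticOfType g a b) : ∃ (c : ℂ) (X : GL (Fin 3) ℂ),
      g.1 = X.1 * Matrix.diagonal ![c, c * Complex.exp (2 * Real.pi * a * Complex.I),
        c * Complex.exp (2 * Real.pi * b * Complex.I)] * (X⁻¹).1 := by
  obtain ⟨c, v, v₁, v₂, hv, hv₁, hv₂, h01, h02, h12, hg0, hg1, hg2⟩ := h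
  refine ⟨c, ?_⟩
  set D := Matrix.diagonal ![c, c * Complex.exp (2 * Real.pi * a * Complex.I),
        c * Complex.exp (2 * Real.pi * b * Complex.I)]
  set X : Matrix (Fin 3) (Fin 3) ℂ := Matrix.of fun i j => ![v, v₁, v₂] j i with hX
  have hXv : ∀ x, X *ᵥ x = x 0 • v + x 1 • v₁ + x 2 • v₂ := by
    intro x
    ext i
    simp [hX, Matrix.mulVec, dotProduct, Fin.sum_univ_three, mul_comm]
  have hdet : X.det ≠ 0 := by
    intro h0
    obtain ⟨x, hx, hXx⟩ := Matrix.exists_mulVec_eq_zero_iff.mpr h0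
    rw [hXv] at hXx
    -- Orthogonal to the negative vector `v`, both `v₁` and `v₂` are positive. So none of the three
    -- is isotropic, and pairing a linear relation with each of them kills its coefficients.
    have hpos1 := re_herm_self_pos hv h01 hv₁
    have hpos2 := re_herm_self_pos hv h02 hv₂
    have h10 : herm v₁ v = 0 := by rw [← star_herm, h01, star_zero]
    have h20 : herm v₂ v = 0 := by rw [← star_herm, h02, star_zero]
    have h21 : herm v₂ v₁ = 0 := by rw [← star_herm, h12, star_zero]
    have hz : ∀ y, herm y (0 : Fin 3 → ℂ) = 0 := by intro y; simp [herm]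
    have e0 := congrArg (herm v) hXx
    have e1 := congrArg (herm v₁) hXx
    have e2 := congrArg (herm v₂) hXx
    simp only [herm_add_right, herm_smul_right, h01, h02, h12, h10, h20, h21, mul_zero, add_zero,
      zero_add, hz, mul_eq_zero] at e0 e1 e2
    have n0 : herm v v ≠ 0 := fun h => by rw [h] at hv; simp at hv
    have n1 : herm v₁ v₁ ≠ 0 := fun h => by rw [h] at hpos1; simp at hpos1
    have n2 : herm v₂ v₂ ≠ 0 := fun h => by rw [h] at hpos2; simp at hpos2
    apply hx
    ext i
    fin_cases i
    · exact e0.resolve_right n0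
    · exact e1.resolve_right n1
    · exact e2.resolve_right n2
  refine ⟨Matrix.GeneralLinearGroup.mkOfDetNeZero X hdet, ?_⟩
  have hcomm : g.1 * X = X * D := by
    ext i j
    have hcol : (g.1 * X) i j = (g.1 *ᵥ (![v, v₁, v₂] j)) i := by
      simp [hX, Matrix.mul_apply, Matrix.mulVec, dotProduct]
    rw [hcol, Matrix.mul_diagonal]
    fin_cases j
    · simp [hX, hg0, mul_comm]
    · simp [hX, hg1, mul_comm]
    · simp [hX, hg2, mul_comm]
  have hval : g.1 * (Matrix.GeneralLinearGroup.mkOfDetNeZero X hdet).1 =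
      (Matrix.GeneralLinearGroup.mkOfDetNeZero X hdet).1 * D := hcomm
  rw [← hval, Matrix.mul_assoc, Units.mul_inv, Matrix.mul_one]

/-- The unknown scalar c satisfies c³ = det U = 1. It is also real, because tr U and 1 + 2cos θ are
real and the latter is nonzero; hence c = 1. Comparing traces then determines cos 2α, and the
eigenvalues are n-th roots of unity. -/
theorem cos_and_pow_of_elliptic {α : ℝ} {n : ℕ} (hn : 9 ≤ n)
    (hU : IsEllipticOfType (U α) (1 / (n : ℝ)) (-1 / (n : ℝ))) :
    ei α ^ 2 + (ei α)⁻¹ ^ 2 = ((Real.cos (2 * Real.pi / n) - 3 / 2 : ℝ) : ℂ) ∧ U α ^ n = 1 := by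
  obtain ⟨c, X, hX⟩ := hU.exists_diagonalization
  have hn0 : (n : ℝ) ≠ 0 := by positivity
  have hn0' : (n : ℂ) ≠ 0 := by exact_mod_cast hn0
  set θ : ℝ := 2 * Real.pi / n with hθ
  have hw1 : Complex.exp (2 * Real.pi * (1 / (n : ℝ) : ℝ) * Complex.I)
      = Complex.exp (θ * Complex.I) := by
    congr 1; rw [hθ]; push_cast; ring
  have hw2 : Complex.exp (2 * Real.pi * (-1 / (n : ℝ) : ℝ) * Complex.I)
      = Complex.exp (-θ * Complex.I) := by
    congr 1; rw [hθ]; push_cast; ring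
  rw [hw1, hw2] at hX
  have hsum : Complex.exp (θ * Complex.I) + Complex.exp (-θ * Complex.I)
      = ((2 * Real.cos θ : ℝ) : ℂ) := by
    push_cast
    rw [Complex.two_cos]
  have hprod : Complex.exp (θ * Complex.I) * Complex.exp (-θ * Complex.I) = 1 := by
    rw [← Complex.exp_add]; simp
  have hw1n : Complex.exp (θ * Complex.I) ^ n = 1 := by
    rw [← Complex.exp_nat_mul, ← Complex.exp_two_pi_mul_I]
    congr 1; rw [hθ]; push_cast; field_simp
  have hw2n : Complex.exp (-θ * Complex.I) ^ n = 1 := by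
    have h := congrArg (· ^ n) hprod
    simpa only [mul_pow, hw1n, one_mul, one_pow] using h
  have htr : (U α).1.trace = c * ((1 + 2 * Real.cos θ : ℝ) : ℂ) := by
    rw [hX, Matrix.mul_assoc, Matrix.trace_mul_comm, Matrix.mul_assoc, Units.inv_mul,
      Matrix.mul_one, Matrix.trace_diagonal, Fin.sum_univ_three]
    simp only [Matrix.cons_val]
    push_cast at hsum ⊢
    linear_combination c * hsum
  have hdet : c ^ 3 = 1 := by
    have h := det_U α
    have hXX : X.1.det * (X⁻¹).1.det = 1 := by
      rw [← Matrix.det_mul, Units.mul_inv, Matrix.det_one]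
    rw [hX, Matrix.det_mul, Matrix.det_mul, Matrix.det_diagonal, Fin.prod_univ_three] at h
    simp only [Matrix.cons_val] at h
    linear_combination h - c ^ 3 * hXX - c ^ 3 * X.1.det * (X⁻¹).1.det * hprod
  have hcos : 0 < Real.cos θ := by
    apply Real.cos_pos_of_mem_Ioo
    have h9 : (9 : ℝ) ≤ n := by exact_mod_cast hn
    have : 0 < θ := by positivity
    have h4 : θ < Real.pi / 2 := by
      rw [hθ, div_lt_iff₀ (by positivity)]
      nlinarith [Real.pi_pos]
    constructor <;> linarith [Real.pi_pos]
  have htr' : (U α).1.trace = ((4 + 4 * Real.cos (2 * α) : ℝ) : ℂ) := by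
    rw [trace_U, ← star_ei, ei, Complex.star_def, ← Complex.exp_conj, ← Complex.exp_nat_mul,
      ← Complex.exp_nat_mul]
    push_cast
    have := Complex.two_cos (2 * α)
    simp only [map_mul, Complex.conj_ofReal, Complex.conj_I]
    rw [show (2 : ℂ) * (α * Complex.I) = 2 * α * Complex.I by ring,
      show (2 : ℂ) * (α * -Complex.I) = -(2 * α) * Complex.I by ring]
    linear_combination -2 * this
  have hreal : c = (((4 + 4 * Real.cos (2 * α)) / (1 + 2 * Real.cos θ) : ℝ) : ℂ) := by
    have : ((1 + 2 * Real.cos θ : ℝ) : ℂ) ≠ 0 := by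
      exact_mod_cast (by positivity : (1 + 2 * Real.cos θ) ≠ 0)
    rw [Complex.ofReal_div, eq_div_iff this, ← htr, htr']
  have hc : c = 1 := by
    rw [hreal] at hdet ⊢
    generalize (4 + 4 * Real.cos (2 * α)) / (1 + 2 * Real.cos θ) = x at *
    have hx : x ^ 3 = 1 := by exact_mod_cast hdet
    have : x = 1 := by nlinarith [sq_nonneg (x + 1), sq_nonneg (x - 1), sq_nonneg x]
    rw [this, Complex.ofReal_one]
  constructor
  · rw [trace_U, hc] at htr
    push_cast at htr ⊢
    linear_combination htr / 2
  · have hconj : ∀ m : ℕ, (U α).1 ^ m = X.1 * (Matrix.diagonal ![c, c * Complex.exp (θ * Complex.I),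
        c * Complex.exp (-θ * Complex.I)]) ^ m * (X⁻¹).1 := by
      intro m
      rw [hX]
      exact Units.conj_pow X _ m
    apply Units.ext
    rw [Units.val_pow_eq_pow_val, hconj, Matrix.diagonal_pow]
    have : (![c, c * Complex.exp (θ * Complex.I), c * Complex.exp (-θ * Complex.I)] ^ n) = 1 := by
      ext i
      fin_cases i <;> simp [hc, hw1n, hw2n, -neg_mul]
    rw [this, Matrix.diagonal_one', Matrix.mul_one, Units.mul_inv, Units.val_one]

/-! ### Closed forms for the products along an orbit of `U` -/

/-- The coefficient of f k is 1, so the recurrence also runs backwards and three consecutive values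
determine a sequence on all of ℤ. -/
theorem eq_of_third_order_recurrence {t : ℝ} {f g : ℤ → ℝ}
    (hf : ∀ k, f (k + 3) = t * f (k + 2) - t * f (k + 1) + f k)
    (hg : ∀ k, g (k + 3) = t * g (k + 2) - t * g (k + 1) + g k)
    (h₁ : f (-1) = g (-1)) (h₂ : f 0 = g 0) (h₃ : f 1 = g 1) (k : ℤ) : f k = g k := by
  suffices h : f (k - 1) = g (k - 1) ∧ f k = g k ∧ f (k + 1) = g (k + 1) from h.2.1
  induction k using Int.induction_on with
  | zero => exact ⟨by simpa using h₁, h₂, by simpa using h₃⟩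
  | succ i ih =>
    obtain ⟨a, b, c⟩ := ih
    have e1 := hf (i - 1)
    have e2 := hg (i - 1)
    rw [show (i : ℤ) - 1 + 3 = i + 1 + 1 by ring, show (i : ℤ) - 1 + 2 = i + 1 by ring,
      sub_add_cancel] at e1 e2
    refine ⟨by simpa using b, c, ?_⟩
    rw [e1, e2, a, b, c]
  | pred i ih =>
    obtain ⟨a, b, c⟩ := ih
    have e1 := hf (-i - 1 - 1)
    have e2 := hg (-i - 1 - 1)
    rw [show -(i : ℤ) - 1 - 1 + 3 = -i + 1 by ring, show -(i : ℤ) - 1 - 1 + 2 = -i by ring,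
      sub_add_cancel] at e1 e2
    refine ⟨?_, a, by simpa using b⟩
    rw [a, b, c] at e1
    linarith

theorem cos_third_order_recurrence (θ φ : ℝ) (k : ℤ) :
    Real.cos (((k + 3 : ℤ) : ℝ) * θ + φ) =
      (1 + 2 * Real.cos θ) * Real.cos (((k + 2 : ℤ) : ℝ) * θ + φ)
        - (1 + 2 * Real.cos θ) * Real.cos (((k + 1 : ℤ) : ℝ) * θ + φ)
        + Real.cos ((k : ℝ) * θ + φ) := by
  have key : ∀ x, Real.cos (x + θ) + Real.cos (x - θ) = 2 * Real.cos θ * Real.cos x := by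
    intro x
    rw [Real.cos_add, Real.cos_sub]
    ring
  have e1 := key (((k + 2 : ℤ) : ℝ) * θ + φ)
  have e2 := key (((k + 1 : ℤ) : ℝ) * θ + φ)
  push_cast at e1 e2 ⊢
  rw [show ((k : ℝ) + 2) * θ + φ + θ = (k + 3) * θ + φ by ring,
    show ((k : ℝ) + 2) * θ + φ - θ = (k + 1) * θ + φ by ring] at e1
  rw [show ((k : ℝ) + 1) * θ + φ + θ = (k + 2) * θ + φ by ring,
    show ((k : ℝ) + 1) * θ + φ - θ = k * θ + φ by ring] at e2
  linear_combination e1 - e2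

theorem cos_le_cos_of_mem_Icc {a x : ℝ} (ha : 0 ≤ a) (h₁ : a ≤ x) (h₂ : x ≤ 2 * Real.pi - a) :
    Real.cos x ≤ Real.cos a := by
  rcases le_total x Real.pi with hx | hx
  · exact Real.cos_le_cos_of_nonneg_of_le_pi ha hx h₁
  · rw [← Real.cos_two_pi_sub x]
    exact Real.cos_le_cos_of_nonneg_of_le_pi ha (by linarith) (by linarith)

theorem re_herm_zpow_U_recurrence {α C : ℝ}
    (hC : ei α ^ 2 + (ei α)⁻¹ ^ 2 = ((C - 3 / 2 : ℝ) : ℂ)) (x y : Fin 3 → ℂ) (k : ℤ) :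
    (herm x ((U α ^ (k + 3)).1 *ᵥ y)).re =
      (1 + 2 * C) * (herm x ((U α ^ (k + 2)).1 *ᵥ y)).re
        - (1 + 2 * C) * (herm x ((U α ^ (k + 1)).1 *ᵥ y)).re
        + (herm x ((U α ^ k).1 *ᵥ y)).re := by
  have ht : (4 + 2 * (ei α ^ 2 + (ei α)⁻¹ ^ 2)) = ((1 + 2 * C : ℝ) : ℂ) := by
    rw [hC]; push_cast; ring
  have h3 : (U α ^ (k + 3)).1 = ((1 + 2 * C : ℝ) : ℂ) • (U α ^ (k + 2)).1
      - ((1 + 2 * C : ℝ) : ℂ) • (U α ^ (k + 1)).1 + (U α ^ k).1 := by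
    have e : ∀ m : ℕ, (U α ^ (k + m)).1 = (U α ^ k).1 * (U α).1 ^ m := by
      intro m
      rw [_root_.zpow_add, Units.val_mul, zpow_natCast, Units.val_pow_eq_pow_val]
    have e1 := e 1
    have e2 := e 2
    have e3 := e 3
    simp only [Nat.cast_one, Nat.cast_ofNat] at e1 e2 e3
    rw [e1, e2, e3, U_pow_three, ht, Matrix.mul_add, Matrix.mul_sub, Matrix.mul_smul,
      Matrix.mul_smul, Matrix.mul_one, pow_one]
  rw [h3, Matrix.add_mulVec, Matrix.sub_mulVec, Matrix.smul_mulVec, Matrix.smul_mulVec,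
    herm_add_right, herm_sub_right, herm_smul_right, herm_smul_right, Complex.add_re,
    Complex.sub_re, Complex.re_ofReal_mul, Complex.re_ofReal_mul]

theorem herm_zpow_neg_U (α : ℝ) (k : ℤ) (x y : Fin 3 → ℂ) :
    herm x ((U α ^ (-k)).1 *ᵥ y) = herm ((U α ^ k).1 *ᵥ x) y := by
  rw [← herm_zpow_U α k x, Matrix.mulVec_mulVec, ← Units.val_mul, ← _root_.zpow_add, add_neg_cancel,
    zpow_zero, Units.val_one, Matrix.one_mulVec]

/-- The sequence is even in k because `U` is an isometry, so no sine term occurs. The factor 1 - cos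
θ clears the denominator. -/
theorem re_herm_zpow_U_self {α θ : ℝ} {p : Fin 3 → ℂ}
    (hC : ei α ^ 2 + (ei α)⁻¹ ^ 2 = ((Real.cos θ - 3 / 2 : ℝ) : ℂ))
    (h0 : (herm p p).re = -(1 - Real.cos θ))
    (h1 : (herm p ((U α).1 *ᵥ p)).re = -(9 / 4) - (1 - Real.cos θ) * Real.cos θ) (k : ℤ) :
    (1 - Real.cos θ) * (herm p ((U α ^ k).1 *ᵥ p)).re =
      -(9 / 4) + (9 / 4 - (1 - Real.cos θ) ^ 2) * Real.cos (k * θ) := by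
  refine eq_of_third_order_recurrence (t := 1 + 2 * Real.cos θ)
    (f := fun k : ℤ => (1 - Real.cos θ) * (herm p ((U α ^ k).1 *ᵥ p)).re)
    (g := fun k : ℤ => -(9 / 4) + (9 / 4 - (1 - Real.cos θ) ^ 2) * Real.cos (k * θ))
    (fun k => ?_) (fun k => ?_) ?_ ?_ ?_ k
  · rw [re_herm_zpow_U_recurrence hC]
    ring
  · have := cos_third_order_recurrence θ 0 k
    simp only [add_zero] at this
    rw [this]
    ring
  · rw [herm_zpow_neg_U, zpow_one, re_herm_comm, h1]
    simp only [Int.reduceNeg, Int.cast_neg, Int.cast_one, neg_mul, one_mul, Real.cos_neg]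
    ring
  · simp only [zpow_zero, Units.val_one, Matrix.one_mulVec, h0, Int.cast_zero, zero_mul,
      Real.cos_zero]
    ring
  · simp only [zpow_one, h1, Int.cast_one, one_mul]
    ring

/-- The values at k = -1 and k = 0 are both -3/2, which makes the sequence symmetric under k ↦ -1 -
k; this explains the phase θ/2. The prefactor clears denominators. -/
theorem re_herm_pV_zpow_U_pW {α θ : ℝ}
    (hC : ei α ^ 2 + (ei α)⁻¹ ^ 2 = ((Real.cos θ - 3 / 2 : ℝ) : ℂ)) (k : ℤ) :
    (1 - Real.cos θ) * Real.cos (θ / 2) * (herm (pV α) ((U α ^ k).1 *ᵥ pW α)).re =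
      -(9 / 4) * Real.cos (θ / 2)
        + (9 / 4 - 3 / 2 * (1 - Real.cos θ)) * Real.cos (k * θ + θ / 2) := by
  refine eq_of_third_order_recurrence (t := 1 + 2 * Real.cos θ)
    (f := fun k : ℤ => (1 - Real.cos θ) * Real.cos (θ / 2) *
      (herm (pV α) ((U α ^ k).1 *ᵥ pW α)).re)
    (g := fun k : ℤ => -(9 / 4) * Real.cos (θ / 2)
        + (9 / 4 - 3 / 2 * (1 - Real.cos θ)) * Real.cos (k * θ + θ / 2))
    (fun k => ?_) (fun k => ?_) ?_ ?_ ?_ k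
  · rw [re_herm_zpow_U_recurrence hC]
    ring
  · rw [cos_third_order_recurrence θ (θ / 2) k]
    ring
  · rw [herm_zpow_neg_U, zpow_one, herm_U_pV_pW,
      show ((-1 : ℤ) : ℝ) * θ + θ / 2 = -(θ / 2) by push_cast; ring, Real.cos_neg]
    norm_num
    ring
  · simp only [zpow_zero, Units.val_one, Matrix.one_mulVec, herm_pV_pW, Int.cast_zero, zero_mul,
      zero_add]
    norm_num
    ring
  · simp only [zpow_one, re_herm_pV_U_pW hC]
    have hθ : Real.cos θ = 2 * Real.cos (θ / 2) ^ 2 - 1 := by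
      rw [← Real.cos_two_mul]; ring_nf
    rw [show ((1 : ℤ) : ℝ) * θ + θ / 2 = 3 * (θ / 2) by push_cast; ring, Real.cos_three_mul, hθ]
    ring

/-! ### Action of `U` on the bisectors -/

theorem U_inv_mulVec_pU (α : ℝ) : (U α)⁻¹.1 *ᵥ pU α = pU α := by
  nth_rewrite 1 [← U_mulVec_pU]
  rw [Matrix.mulVec_mulVec, Units.inv_mul, Matrix.one_mulVec]

theorem zpow_U_mulVec_pU (α : ℝ) (k : ℤ) : (U α ^ k).1 *ᵥ pU α = pU α := by
  induction k using Int.induction_on with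
  | zero => simp
  | succ i ih =>
    rw [_root_.zpow_add_one, Units.val_mul, ← Matrix.mulVec_mulVec, U_mulVec_pU, ih]
  | pred i ih =>
    rw [_root_.zpow_sub_one, Units.val_mul, ← Matrix.mulVec_mulVec, U_inv_mulVec_pU, ih]

theorem herm_pU_zpow_U (α : ℝ) (k : ℤ) (x : Fin 3 → ℂ) :
    herm (pU α) ((U α ^ k).1 *ᵥ x) = herm (pU α) x := by
  rw [← herm_zpow_U α k (pU α) x, zpow_U_mulVec_pU]

theorem zpow_U_eq_of_modEq {α : ℝ} {n : ℕ} (h : U α ^ n = 1) {j k : ℤ} (hjk : j ≡ k [ZMOD n]) :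
    U α ^ j = U α ^ k := by
  rw [zpow_eq_zpow_emod' j h, zpow_eq_zpow_emod' k h, hjk]

theorem act_mk (g : GL (Fin 3) ℂ) (v : Fin 3 → ℂ) (hv : v ≠ 0) (hgv : g.1 *ᵥ v ≠ 0) :
    act g (Projectivization.mk ℂ v hv) = Projectivization.mk ℂ (g.1 *ᵥ v) hgv := rfl

theorem mulVec_ne_zero (g : GL (Fin 3) ℂ) {v : Fin 3 → ℂ} (hv : v ≠ 0) : g.1 *ᵥ v ≠ 0 := by
  intro h
  apply hv
  rw [← Matrix.one_mulVec v, ← Units.val_one, ← inv_mul_cancel g, Units.val_mul,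
    ← Matrix.mulVec_mulVec, h, Matrix.mulVec_zero]

theorem act_mem_bisector_iff {g : GL (Fin 3) ℂ} (hg : g ∈ isometryGroup) (p q : Fin 3 → ℂ)
    (z : CP2) : act g z ∈ bisector (g.1 *ᵥ p) (g.1 *ᵥ q) ↔ z ∈ bisector p q := by
  induction z using Projectivization.ind with
  | h v hv =>
    rw [act_mk g v hv (mulVec_ne_zero g hv), mk_mem_bisector_iff, mk_mem_bisector_iff, hg, hg, hg]

theorem act_zpow_U_mem_bisector_iff (α : ℝ) (j k : ℤ) (p : Fin 3 → ℂ) (z : CP2) :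
    act (U α ^ j) z ∈ bisector (pU α) ((U α ^ (j + k)).1 *ᵥ p) ↔
      z ∈ bisector (pU α) ((U α ^ k).1 *ᵥ p) := by
  have h := act_mem_bisector_iff (zpow_mem (U_mem_isometryGroup α) j) (pU α)
    ((U α ^ k).1 *ᵥ p) z
  rwa [zpow_U_mulVec_pU, Matrix.mulVec_mulVec, ← Units.val_mul, ← _root_.zpow_add] at h

theorem act_U_mem_Jplus {α : ℝ} {k l : ℤ} {z : CP2} (hz : z ∈ Jplus α k) (h : 1 + k = l) :
    act (U α) z ∈ Jplus α l := by
  subst h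
  have := (act_zpow_U_mem_bisector_iff α 1 k (pV α) z).mpr hz
  rwa [zpow_one] at this

theorem act_U_mem_Jminus {α : ℝ} {k l : ℤ} {z : CP2} (hz : z ∈ Jminus α k) (h : 1 + k = l) :
    act (U α) z ∈ Jminus α l := by
  subst h
  have := (act_zpow_U_mem_bisector_iff α 1 k (pW α) z).mpr hz
  rwa [zpow_one] at this

theorem act_U_inv_mem_Jplus {α : ℝ} {k l : ℤ} {z : CP2} (hz : z ∈ Jplus α k) (h : -1 + k = l) :
    act (U α)⁻¹ z ∈ Jplus α l := by
  subst h
  have := (act_zpow_U_mem_bisector_iff α (-1) k (pV α) z).mpr hz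
  rwa [_root_.zpow_neg_one] at this

theorem act_U_inv_mem_Jminus {α : ℝ} {k l : ℤ} {z : CP2} (hz : z ∈ Jminus α k)
    (h : -1 + k = l) : act (U α)⁻¹ z ∈ Jminus α l := by
  subst h
  have := (act_zpow_U_mem_bisector_iff α (-1) k (pW α) z).mpr hz
  rwa [_root_.zpow_neg_one] at this

/-! ### Points [p_A] and [p_B] on the bisectors -/

theorem norm_ei (α : ℝ) : ‖ei α‖ = 1 := Complex.norm_exp_ofReal_mul_I α

theorem herm_ptA (x : Fin 3 → ℂ) : herm ![1, 0, 0] x = x 2 := by simp [herm]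

theorem herm_ptB (x : Fin 3 → ℂ) : herm ![0, 0, 1] x = x 0 := by simp [herm]

theorem ptA_mem_Jplus_zero (α : ℝ) : ptA ∈ Jplus α 0 := by
  rw [Jplus, ptA, mk_mem_bisector_iff]
  simp [herm_ptA, pV_eq, pU, norm_ei]

theorem ptA_mem_Jminus_zero (α : ℝ) : ptA ∈ Jminus α 0 := by
  rw [Jminus, ptA, mk_mem_bisector_iff]
  simp [herm_ptA, pW_eq, pU, norm_ei]

theorem ptB_mem_Jplus_zero (α : ℝ) : ptB ∈ Jplus α 0 := by
  rw [Jplus, ptB, mk_mem_bisector_iff]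
  simp [herm_ptB, pV_eq, pU, norm_ei]

theorem ptB_mem_Jminus_zero (α : ℝ) : ptB ∈ Jminus α 0 := by
  rw [Jminus, ptB, mk_mem_bisector_iff]
  simp [herm_ptB, pW_eq, pU, norm_ei]

theorem ptA_mem_Jplus_neg_one (α : ℝ) : ptA ∈ Jplus α (-1) := by
  have h1 : ei α * (ei α)⁻¹ = 1 := mul_inv_cancel₀ (ei_ne_zero α)
  have h2 := sqrt_two_mul_self
  have h : herm ((U α).1 *ᵥ ![1, 0, 0]) (pV α) = ei α ^ 2 := by
    simp only [U_val, pV_eq, herm, Matrix.mulVec, dotProduct, Fin.sum_univ_three, Matrix.of_apply,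
      Matrix.cons_val, star_add, star_mul', star_neg, star_sqrt_two, star_ei, star_one, star_zero]
    grind
  rw [Jplus, ptA, mk_mem_bisector_iff, herm_zpow_neg_U, zpow_one, h]
  simp [herm_ptA, pU, norm_ei]

theorem ptB_mem_Jplus_one (α : ℝ) : ptB ∈ Jplus α 1 := by
  have h2 := sqrt_two_mul_self
  have h : ((U α).1 *ᵥ pV α) 0 = 1 := by
    simp only [U_val, pV_eq, Matrix.mulVec, dotProduct, Fin.sum_univ_three, Matrix.of_apply,
      Matrix.cons_val]
    grind
  rw [Jplus, ptB, mk_mem_bisector_iff, zpow_one, herm_ptB, herm_ptB, herm_ptB, h]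
  simp [pU]

theorem ptB_mem_Jminus_neg_one (α : ℝ) : ptB ∈ Jminus α (-1) := by
  have h1 : ei α * (ei α)⁻¹ = 1 := mul_inv_cancel₀ (ei_ne_zero α)
  have h2 := sqrt_two_mul_self
  have h : herm ((U α).1 *ᵥ ![0, 0, 1]) (pW α) = 1 := by
    simp only [U_val, pW_eq, herm, Matrix.mulVec, dotProduct, Fin.sum_univ_three, Matrix.of_apply,
      Matrix.cons_val, star_add, star_mul', star_neg, star_pow, star_sqrt_two, star_ei,
      star_ei_inv, star_one, star_zero, star_ofNat]
    grind
  rw [Jminus, ptB, mk_mem_bisector_iff, herm_zpow_neg_U, zpow_one, h]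
  simp [herm_ptB, pU]

/-! ### The bound for the bisectors of the two orbits -/

theorem le_re_herm_of_mem_bisector {α θ : ℝ} {p q : Fin 3 → ℂ} {z : CP2}
    (hC : ei α ^ 2 + (ei α)⁻¹ ^ 2 = ((Real.cos θ - 3 / 2 : ℝ) : ℂ))
    (h₀ : 0 < Real.cos θ) (h₁ : Real.cos θ < 1)
    (hup : herm (pU α) p = -(3 / 2)) (huq : herm (pU α) q = -(3 / 2))
    (hpp : herm p p = herm (pU α) (pU α)) (hqq : herm q q = herm (pU α) (pU α))
    (hp : z ∈ bisector (pU α) p) (hq : z ∈ bisector (pU α) q) :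
    3 * (1 - Real.cos θ) - 6 ≤ (herm p q).re ∧
      ((herm p q).re = 3 * (1 - Real.cos θ) - 6 →
        ∃ c : ℂ, c ≠ 0 ∧ c • z.rep = p + q - (2 : ℂ) • pU α) := by
  have huu : herm (pU α) (pU α) = -((1 - Real.cos θ : ℝ) : ℂ) := by
    rw [herm_pU_pU, hC]; push_cast; ring
  exact le_re_herm_of_equidistant (by linarith) (by linarith) huu hup huq (hpp.trans huu)
    (hqq.trans huu) z.rep_nonzero hp.1 hp.2 hq.2

theorem le_re_herm_of_mem_bisector_zpow {α θ : ℝ} {p q : Fin 3 → ℂ} {k : ℤ} {z : CP2}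
    (hC : ei α ^ 2 + (ei α)⁻¹ ^ 2 = ((Real.cos θ - 3 / 2 : ℝ) : ℂ))
    (h₀ : 0 < Real.cos θ) (h₁ : Real.cos θ < 1)
    (hup : herm (pU α) p = -(3 / 2)) (huq : herm (pU α) q = -(3 / 2))
    (hpp : herm p p = herm (pU α) (pU α)) (hqq : herm q q = herm (pU α) (pU α))
    (hz : z ∈ bisector (pU α) ((U α ^ (0 : ℤ)).1 *ᵥ p) ∩ bisector (pU α) ((U α ^ k).1 *ᵥ q)) :
    3 * (1 - Real.cos θ) - 6 ≤ (herm p ((U α ^ k).1 *ᵥ q)).re ∧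
      ((herm p ((U α ^ k).1 *ᵥ q)).re = 3 * (1 - Real.cos θ) - 6 →
        ∃ c : ℂ, c ≠ 0 ∧ c • z.rep = p + (U α ^ k).1 *ᵥ q - (2 : ℂ) • pU α) := by
  rw [zpow_zero, Units.val_one, Matrix.one_mulVec] at hz
  exact le_re_herm_of_mem_bisector hC h₀ h₁ hup (by rw [herm_pU_zpow_U, huq]) hpp
    (by rw [herm_zpow_U, hqq]) hz.1 hz.2

theorem eq_of_smul_rep_eq {z w : CP2} {x : Fin 3 → ℂ} (hz : ∃ c : ℂ, c ≠ 0 ∧ c • z.rep = x)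
    (hw : ∃ c : ℂ, c ≠ 0 ∧ c • w.rep = x) : z = w := by
  obtain ⟨c, hc, h⟩ := hz
  obtain ⟨d, hd, h'⟩ := hw
  rw [← z.mk_rep, ← w.mk_rep, Projectivization.mk_eq_mk_iff']
  refine ⟨c⁻¹ * d, ?_⟩
  rw [mul_smul, h', ← h, smul_smul, inv_mul_cancel₀ hc, one_smul]

/-- The bisectors meet in at most one point when the lower bound on the Hermitian product
is attained. -/
theorem Jplus_inter_Jminus_eq_singleton {α θ : ℝ} {k : ℤ} {w : CP2}
    (hC : ei α ^ 2 + (ei α)⁻¹ ^ 2 = ((Real.cos θ - 3 / 2 : ℝ) : ℂ))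
    (h₀ : 0 < Real.cos θ) (h₁ : Real.cos θ < 1)
    (hk : (herm (pV α) ((U α ^ k).1 *ᵥ pW α)).re = 3 * (1 - Real.cos θ) - 6)
    (hw : w ∈ Jplus α 0 ∩ Jminus α k) : Jplus α 0 ∩ Jminus α k = {w} := by
  have key : ∀ z ∈ Jplus α 0 ∩ Jminus α k, ∃ c : ℂ, c ≠ 0 ∧
      c • z.rep = pV α + (U α ^ k).1 *ᵥ pW α - (2 : ℂ) • pU α := fun z hz =>
    (le_re_herm_of_mem_bisector_zpow hC h₀ h₁ (herm_pU_pV α) (herm_pU_pW α) (herm_pV_pV α)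
      (herm_pW_pW α) hz).2 hk
  exact Set.Subset.antisymm (fun z hz => eq_of_smul_rep_eq (key z hz) (key w hw))
    (Set.singleton_subset_iff.mpr hw)

/-! ### Trigonometric estimates away from the listed residues -/

theorem cos_two_pi_div_bounds {n : ℕ} (hn : 9 ≤ n) :
    1 / 2 < Real.cos (2 * Real.pi / n) ∧ Real.cos (2 * Real.pi / n) < 1 ∧
      0 < Real.cos (2 * Real.pi / n / 2) := by
  have h9 : (9 : ℝ) ≤ n := by exact_mod_cast hn
  have hpi := Real.pi_pos
  have hpos : 0 < 2 * Real.pi / (n : ℝ) := by positivity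
  have hlt : 2 * Real.pi / (n : ℝ) < Real.pi / 3 := by
    rw [div_lt_iff₀ (by positivity)]
    nlinarith
  refine ⟨?_, ?_, ?_⟩
  · rw [← Real.cos_pi_div_three]
    exact Real.cos_lt_cos_of_nonneg_of_le_pi hpos.le (by linarith) hlt
  · rw [← Real.cos_zero]
    exact Real.cos_lt_cos_of_nonneg_of_le_pi le_rfl (by linarith) hpos
  · exact Real.cos_pos_of_mem_Ioo ⟨by linarith, by linarith⟩

/-- By periodicity k may be replaced by its residue r. The hypotheses place (r + a)θ between (m +
a)θ and 2π - (m + a)θ, where the cosine is largest at the ends. -/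
theorem cos_int_mul_add_le {n : ℕ} (hn : 9 ≤ n) {k m : ℤ} {a : ℝ} (ha : 0 ≤ m + a)
    (h₁ : m ≤ k % n) (h₂ : ((k % n : ℤ) : ℝ) + 2 * a + m ≤ n) :
    Real.cos (k * (2 * Real.pi / n) + a * (2 * Real.pi / n)) ≤
      Real.cos ((m + a) * (2 * Real.pi / n)) := by
  have hn0 : (0 : ℝ) < n := by positivity
  have hpi := Real.pi_pos
  have hpos : 0 < 2 * Real.pi / (n : ℝ) := by positivity
  have hk : (k : ℝ) = (k % n : ℤ) + n * (k / n : ℤ) := by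
    exact_mod_cast (Int.emod_add_mul_ediv k n).symm
  have hx : (k : ℝ) * (2 * Real.pi / n) + a * (2 * Real.pi / n)
      = ((k % n : ℤ) + a) * (2 * Real.pi / n) + (k / n : ℤ) * (2 * Real.pi) := by
    rw [hk]
    field_simp
    ring
  rw [hx, Real.cos_add_int_mul_two_pi]
  have h₁' : (m : ℝ) ≤ (k % n : ℤ) := by exact_mod_cast h₁
  apply cos_le_cos_of_mem_Icc (by positivity)
  · gcongr
  · have : 2 * Real.pi - (m + a) * (2 * Real.pi / n) = (n - (m + a)) * (2 * Real.pi / n) := by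
      field_simp
    rw [this]
    gcongr
    linarith

theorem re_herm_zpow_U_self_lt {α : ℝ} {n : ℕ} (hn : 9 ≤ n) {p : Fin 3 → ℂ}
    (hC : ei α ^ 2 + (ei α)⁻¹ ^ 2 = ((Real.cos (2 * Real.pi / n) - 3 / 2 : ℝ) : ℂ))
    (h0 : (herm p p).re = -(1 - Real.cos (2 * Real.pi / n)))
    (h1 : (herm p ((U α).1.mulVec p)).re =
      -(9 / 4) - (1 - Real.cos (2 * Real.pi / n)) * Real.cos (2 * Real.pi / n)) {k : ℤ}
    (hk₁ : 2 ≤ k % n) (hk₂ : k % n + 2 ≤ n) :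
    (herm p ((U α ^ k).1.mulVec p)).re < 3 * (1 - Real.cos (2 * Real.pi / n)) - 6 := by
  obtain ⟨hc₁, hc₂, -⟩ := cos_two_pi_div_bounds hn
  have hX := re_herm_zpow_U_self hC h0 h1 k
  have hcos := cos_int_mul_add_le (a := 0) hn (m := 2) (k := k) (by norm_num) hk₁ (by
    have : ((k % n : ℤ) : ℝ) + 2 ≤ n := by exact_mod_cast hk₂
    rw [Int.cast_ofNat]
    linarith)
  simp only [zero_mul, add_zero, Int.cast_ofNat] at hcos
  rw [Real.cos_two_mul] at hcos
  generalize Real.cos (2 * Real.pi / n) = c at *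
  generalize Real.cos (k * (2 * Real.pi / n)) = y at *
  generalize (herm p ((U α ^ k).1.mulVec p)).re = x at *
  obtain ⟨N, rfl⟩ : ∃ N, c = 1 - N := ⟨1 - c, by ring⟩
  simp only [sub_sub_cancel] at *
  have hN : 0 < N := by linarith
  have hN2 : N < 1 / 2 := by linarith
  have hpos : 0 ≤ 9 / 4 - N ^ 2 := by nlinarith
  have h := mul_le_mul_of_nonneg_left hcos hpos
  by_contra! hge
  have h' := mul_le_mul_of_nonneg_left hge hN.le
  -- This is N(3N - 6) minus the closed form with cos kθ replaced by its bound cos 2θ = 1 - 4N +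
  -- 2N².
  have : 0 < N * (3 - 1 / 2 * N - 4 * N ^ 2 + 2 * N ^ 3) := by
    apply mul_pos hN
    have : 0 < N ^ 3 := by positivity
    nlinarith
  nlinarith

theorem re_herm_pV_zpow_U_pW_lt {α : ℝ} {n : ℕ} (hn : 9 ≤ n)
    (hC : ei α ^ 2 + (ei α)⁻¹ ^ 2 = ((Real.cos (2 * Real.pi / n) - 3 / 2 : ℝ) : ℂ)) {k : ℤ}
    (hk₁ : 2 ≤ k % n) (hk₂ : k % n + 3 ≤ n) :
    (herm (pV α) ((U α ^ k).1.mulVec (pW α))).re <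
      3 * (1 - Real.cos (2 * Real.pi / n)) - 6 := by
  obtain ⟨hc₁, hc₂, hc₃⟩ := cos_two_pi_div_bounds hn
  have hX := re_herm_pV_zpow_U_pW hC k
  have hcos := cos_int_mul_add_le (a := 1 / 2) hn (m := 2) (k := k) (by norm_num) hk₁ (by
    have : ((k % n : ℤ) : ℝ) + 3 ≤ n := by exact_mod_cast hk₂
    push_cast
    linarith)
  rw [show (1 / 2 : ℝ) * (2 * Real.pi / n) = 2 * Real.pi / n / 2 by ring,
    show ((2 : ℤ) + 1 / 2 : ℝ) * (2 * Real.pi / n)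
      = 2 * (2 * Real.pi / n) + 2 * Real.pi / n / 2 by push_cast; ring] at hcos
  generalize 2 * Real.pi / (n : ℝ) = θ at *
  -- The extreme angle is 5θ/2. Factoring out cos(θ/2) leaves a polynomial in cos θ, as in the
  -- diagonal case.
  have hexp : Real.cos (2 * θ + θ / 2) =
      Real.cos (θ / 2) * (4 * Real.cos θ ^ 2 - 2 * Real.cos θ - 1) := by
    have hθ : Real.cos θ = 2 * Real.cos (θ / 2) ^ 2 - 1 := by
      rw [← Real.cos_two_mul]; ring_nf
    have hs : Real.sin θ = 2 * Real.sin (θ / 2) * Real.cos (θ / 2) := by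
      rw [← Real.sin_two_mul]; ring_nf
    have hsq : Real.sin (θ / 2) ^ 2 = 1 - Real.cos (θ / 2) ^ 2 := Real.sin_sq _
    rw [Real.cos_add, Real.cos_two_mul, Real.sin_two_mul, hs, hθ]
    linear_combination
      (-4 * Real.cos (θ / 2) * (2 * Real.cos (θ / 2) ^ 2 - 1)) * hsq
  rw [hexp] at hcos
  generalize Real.cos (k * θ + θ / 2) = y at *
  generalize Real.cos (θ / 2) = d at *
  generalize Real.cos θ = c at *
  generalize (herm (pV α) ((U α ^ k).1.mulVec (pW α))).re = x at *
  obtain ⟨N, rfl⟩ : ∃ N, c = 1 - N := ⟨1 - c, by ring⟩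
  simp only [sub_sub_cancel] at *
  have hN : 0 < N := by linarith
  have hN2 : N < 1 / 2 := by linarith
  have hpos : 0 ≤ 9 / 4 - 3 / 2 * N := by linarith
  have h := mul_le_mul_of_nonneg_left hcos hpos
  by_contra! hge
  have h' := mul_le_mul_of_nonneg_left hge (mul_pos hN hc₃).le
  -- The gap between d N(3N - 6) and the closed form at the extreme angle, where cos(5θ/2) = d(1 -
  -- 6N + 4N²).
  have : 0 < d * N * (9 - 15 * N + 6 * N ^ 2) := by
    apply mul_pos (mul_pos hc₃ hN)
    nlinarith
  nlinarith

/-! ### Residues modulo n and the intersection statements -/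

theorem two_le_emod_of_not_modEq {n : ℕ} (hn : 9 ≤ n) {k : ℤ} (h₀ : ¬ k ≡ 0 [ZMOD n])
    (h₁ : ¬ k ≡ 1 [ZMOD n]) (h₂ : ¬ k ≡ -1 [ZMOD n]) : 2 ≤ k % n ∧ k % n + 2 ≤ n := by
  have hr : (0 : ℤ) < n := by omega
  have hr0 := Int.emod_nonneg k hr.ne'
  have hr1 := Int.emod_lt_of_pos k hr
  have e0 : (0 : ℤ) % n = 0 := Int.zero_emod _
  have e1 : (1 : ℤ) % n = 1 := Int.emod_eq_of_lt (by omega) (by omega)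
  have e2 : (-1 : ℤ) % n = n - 1 := by
    rw [← Int.add_emod_right, Int.emod_eq_of_lt (by omega) (by omega)]
    ring
  rw [Int.ModEq, e0] at h₀
  rw [Int.ModEq, e1] at h₁
  rw [Int.ModEq, e2] at h₂
  omega

theorem emod_add_three_le_of_not_modEq {n : ℕ} (hn : 9 ≤ n) {k : ℤ}
    (h : k % n + 2 ≤ n) (h₂ : ¬ k ≡ -2 [ZMOD n]) : k % n + 3 ≤ n := by
  have e2 : (-2 : ℤ) % n = n - 2 := by
    rw [← Int.add_emod_right, Int.emod_eq_of_lt (by omega) (by omega)]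
    ring
  rw [Int.ModEq, e2] at h₂
  omega

theorem Jplus_eq_of_modEq {α : ℝ} {n : ℕ} (h : U α ^ n = 1) {j k : ℤ} (hjk : j ≡ k [ZMOD n]) :
    Jplus α j = Jplus α k := by
  rw [Jplus, Jplus, zpow_U_eq_of_modEq h hjk]

theorem Jminus_eq_of_modEq {α : ℝ} {n : ℕ} (h : U α ^ n = 1) {j k : ℤ} (hjk : j ≡ k [ZMOD n]) :
    Jminus α j = Jminus α k := by
  rw [Jminus, Jminus, zpow_U_eq_of_modEq h hjk]

theorem act_U_ptA_mem (α : ℝ) : act (U α) ptA ∈ Jplus α 0 ∩ Jminus α 1 :=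
  ⟨act_U_mem_Jplus (ptA_mem_Jplus_neg_one α) (by norm_num),
    act_U_mem_Jminus (ptA_mem_Jminus_zero α) (by norm_num)⟩

theorem act_U_inv_ptB_mem (α : ℝ) : act (U α)⁻¹ ptB ∈ Jplus α 0 ∩ Jminus α (-2) :=
  ⟨act_U_inv_mem_Jplus (ptB_mem_Jplus_one α) (by norm_num),
    act_U_inv_mem_Jminus (ptB_mem_Jminus_neg_one α) (by norm_num)⟩

theorem re_herm_pU_pU {α c : ℝ} (hC : ei α ^ 2 + (ei α)⁻¹ ^ 2 = ((c - 3 / 2 : ℝ) : ℂ)) :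
    (herm (pU α) (pU α)).re = -(1 - c) := by
  have h : herm (pU α) (pU α) = ((-(1 - c) : ℝ) : ℂ) := by
    rw [herm_pU_pU, hC]
    push_cast
    ring
  rw [h, Complex.ofReal_re]

theorem Jplus_inter_Jplus_nonempty_iff {α : ℝ} {n : ℕ} (hn : 9 ≤ n)
    (hC : ei α ^ 2 + (ei α)⁻¹ ^ 2 = ((Real.cos (2 * Real.pi / n) - 3 / 2 : ℝ) : ℂ))
    (hUn : U α ^ n = 1) (k : ℤ) : (Jplus α 0 ∩ Jplus α k).Nonempty ↔
      (k ≡ -1 [ZMOD n] ∨ k ≡ 0 [ZMOD n] ∨ k ≡ 1 [ZMOD n]) := by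
  obtain ⟨hc₁, hc₂, -⟩ := cos_two_pi_div_bounds hn
  constructor
  · rintro ⟨z, hz⟩
    by_contra! hk
    obtain ⟨h₂, h₀, h₁⟩ := hk
    obtain ⟨hk₁, hk₂⟩ := two_le_emod_of_not_modEq hn h₀ h₁ h₂
    have hlt := re_herm_zpow_U_self_lt hn hC (by rw [herm_pV_pV, re_herm_pU_pU hC])
      (re_herm_pV_U_pV hC) hk₁ hk₂
    exact absurd hlt (not_lt.mpr (le_re_herm_of_mem_bisector_zpow hC (by linarith) hc₂
      (herm_pU_pV α) (herm_pU_pV α) (herm_pV_pV α) (herm_pV_pV α) hz).1)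
  · rintro (h | h | h) <;> rw [Jplus_eq_of_modEq hUn h]
    · exact ⟨ptA, ptA_mem_Jplus_zero α, ptA_mem_Jplus_neg_one α⟩
    · exact ⟨ptA, ptA_mem_Jplus_zero α, ptA_mem_Jplus_zero α⟩
    · exact ⟨ptB, ptB_mem_Jplus_zero α, ptB_mem_Jplus_one α⟩

theorem Jminus_inter_Jminus_nonempty_iff {α : ℝ} {n : ℕ} (hn : 9 ≤ n)
    (hC : ei α ^ 2 + (ei α)⁻¹ ^ 2 = ((Real.cos (2 * Real.pi / n) - 3 / 2 : ℝ) : ℂ))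
    (hUn : U α ^ n = 1) (k : ℤ) : (Jminus α 0 ∩ Jminus α k).Nonempty ↔
      (k ≡ -1 [ZMOD n] ∨ k ≡ 0 [ZMOD n] ∨ k ≡ 1 [ZMOD n]) := by
  obtain ⟨hc₁, hc₂, -⟩ := cos_two_pi_div_bounds hn
  constructor
  · rintro ⟨z, hz⟩
    by_contra! hk
    obtain ⟨h₂, h₀, h₁⟩ := hk
    obtain ⟨hk₁, hk₂⟩ := two_le_emod_of_not_modEq hn h₀ h₁ h₂
    have hlt := re_herm_zpow_U_self_lt hn hC (by rw [herm_pW_pW, re_herm_pU_pU hC])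
      (re_herm_pW_U_pW hC) hk₁ hk₂
    exact absurd hlt (not_lt.mpr (le_re_herm_of_mem_bisector_zpow hC (by linarith) hc₂
      (herm_pU_pW α) (herm_pU_pW α) (herm_pW_pW α) (herm_pW_pW α) hz).1)
  · rintro (h | h | h) <;> rw [Jminus_eq_of_modEq hUn h]
    · exact ⟨ptB, ptB_mem_Jminus_zero α, ptB_mem_Jminus_neg_one α⟩
    · exact ⟨ptA, ptA_mem_Jminus_zero α, ptA_mem_Jminus_zero α⟩
    -- [p_B] lies on 𝒥₋₁⁻ and 𝒥₀⁻, and `U` raises both indices by one.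
    · exact ⟨act (U α) ptB, act_U_mem_Jminus (ptB_mem_Jminus_neg_one α) (by norm_num),
        act_U_mem_Jminus (ptB_mem_Jminus_zero α) (by norm_num)⟩

theorem Jplus_inter_Jminus_nonempty_iff {α : ℝ} {n : ℕ} (hn : 9 ≤ n)
    (hC : ei α ^ 2 + (ei α)⁻¹ ^ 2 = ((Real.cos (2 * Real.pi / n) - 3 / 2 : ℝ) : ℂ))
    (hUn : U α ^ n = 1) (k : ℤ) : (Jplus α 0 ∩ Jminus α k).Nonempty ↔
      (k ≡ -2 [ZMOD n] ∨ k ≡ -1 [ZMOD n] ∨ k ≡ 0 [ZMOD n] ∨ k ≡ 1 [ZMOD n]) := by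
  obtain ⟨hc₁, hc₂, -⟩ := cos_two_pi_div_bounds hn
  constructor
  · rintro ⟨z, hz⟩
    by_contra! hk
    obtain ⟨h₃, h₂, h₀, h₁⟩ := hk
    obtain ⟨hk₁, hk₂⟩ := two_le_emod_of_not_modEq hn h₀ h₁ h₂
    have hlt := re_herm_pV_zpow_U_pW_lt hn hC hk₁ (emod_add_three_le_of_not_modEq hn hk₂ h₃)
    exact absurd hlt (not_lt.mpr (le_re_herm_of_mem_bisector_zpow hC (by linarith) hc₂
      (herm_pU_pV α) (herm_pU_pW α) (herm_pV_pV α) (herm_pW_pW α) hz).1)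
  · rintro (h | h | h | h) <;> rw [Jminus_eq_of_modEq hUn h]
    · exact ⟨_, act_U_inv_ptB_mem α⟩
    · exact ⟨ptB, ptB_mem_Jplus_zero α, ptB_mem_Jminus_neg_one α⟩
    · exact ⟨ptA, ptA_mem_Jplus_zero α, ptA_mem_Jminus_zero α⟩
    · exact ⟨_, act_U_ptA_mem α⟩

theorem Jplus_inter_Jminus_one {α : ℝ} {n : ℕ} (hn : 9 ≤ n)
    (hC : ei α ^ 2 + (ei α)⁻¹ ^ 2 = ((Real.cos (2 * Real.pi / n) - 3 / 2 : ℝ) : ℂ)) :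
    Jplus α 0 ∩ Jminus α 1 = {act (U α) ptA} := by
  obtain ⟨hc₁, hc₂, -⟩ := cos_two_pi_div_bounds hn
  exact Jplus_inter_Jminus_eq_singleton hC (by linarith) hc₂
    (by rw [zpow_one, re_herm_pV_U_pW hC]) (act_U_ptA_mem α)

theorem Jplus_inter_Jminus_neg_two {α : ℝ} {n : ℕ} (hn : 9 ≤ n)
    (hC : ei α ^ 2 + (ei α)⁻¹ ^ 2 = ((Real.cos (2 * Real.pi / n) - 3 / 2 : ℝ) : ℂ)) :
    Jplus α 0 ∩ Jminus α (-2) = {act (U α)⁻¹ ptB} := by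
  obtain ⟨hc₁, hc₂, hc₃⟩ := cos_two_pi_div_bounds hn
  refine Jplus_inter_Jminus_eq_singleton hC (by linarith) hc₂ ?_ (act_U_inv_ptB_mem α)
  rw [← re_herm_pV_U_pW hC]
  have e1 := re_herm_pV_zpow_U_pW hC 1
  have e2 := re_herm_pV_zpow_U_pW hC (-2)
  rw [zpow_one] at e1
  -- The symmetry k ↦ -1 - k exchanges -2 and 1, so the extremal value at 1 is also attained at -2.
  have hcos : Real.cos (((-2 : ℤ) : ℝ) * (2 * Real.pi / n) + 2 * Real.pi / n / 2) =
      Real.cos (((1 : ℤ) : ℝ) * (2 * Real.pi / n) + 2 * Real.pi / n / 2) := by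
    rw [← Real.cos_neg]
    congr 1
    push_cast
    ring
  rw [hcos, ← e1] at e2
  exact mul_left_cancel₀ (mul_pos (by linarith) hc₃).ne' e2

end ComplexHyperbolic

theorem mainTheorem1 (α : ℝ) (hα₀ : 0 < α) (hα₁ : α < Real.pi / 2) (n : ℕ) (hn : 9 ≤ n)
    (hU : ComplexHyperbolic.IsEllipticOfType (ComplexHyperbolic.U α)
      (1 / (n : ℝ)) (-1 / (n : ℝ))) :
    (∀ k : ℤ, (ComplexHyperbolic.Jplus α 0 ∩ ComplexHyperbolic.Jplus α k).Nonempty ↔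
      (k ≡ -1 [ZMOD n] ∨ k ≡ 0 [ZMOD n] ∨ k ≡ 1 [ZMOD n])) ∧
    (∀ k : ℤ, (ComplexHyperbolic.Jminus α 0 ∩ ComplexHyperbolic.Jminus α k).Nonempty ↔
      (k ≡ -1 [ZMOD n] ∨ k ≡ 0 [ZMOD n] ∨ k ≡ 1 [ZMOD n])) ∧
    (∀ k : ℤ, (ComplexHyperbolic.Jplus α 0 ∩ ComplexHyperbolic.Jminus α k).Nonempty ↔
      (k ≡ -2 [ZMOD n] ∨ k ≡ -1 [ZMOD n] ∨ k ≡ 0 [ZMOD n] ∨ k ≡ 1 [ZMOD n])) ∧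
    ComplexHyperbolic.Jplus α 0 ∩ ComplexHyperbolic.Jminus α 1 =
      {ComplexHyperbolic.act (ComplexHyperbolic.U α) ComplexHyperbolic.ptA} ∧
    ComplexHyperbolic.Jplus α 0 ∩ ComplexHyperbolic.Jminus α (-2) =
      {ComplexHyperbolic.act (ComplexHyperbolic.U α)⁻¹ ComplexHyperbolic.ptB} := by
  obtain ⟨hC, hUn⟩ := ComplexHyperbolic.cos_and_pow_of_elliptic hn hU
  exact ⟨ComplexHyperbolic.Jplus_inter_Jplus_nonempty_iff hn hC hUn,
    ComplexHyperbolic.Jminus_inter_Jminus_nonempty_iff hn hC hUn,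
    ComplexHyperbolic.Jplus_inter_Jminus_nonempty_iff hn hC hUn,
    ComplexHyperbolic.Jplus_inter_Jminus_one hn hC,
    ComplexHyperbolic.Jplus_inter_Jminus_neg_two hn hC⟩
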